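/- All graphs are finite and simple. A graph is $H$-free if it contains no (not necessarily induced) subgraph isomorphic to $H$, and a graph $G$ is homomorphic to a graph $G'$ if there is a map $f\colon V(G)\to V(G')$ with $f(u)f(v)\in E(G')$ whenever $uv\in E(G)$. The homomorphism threshold $\delta_{\mathrm{hom}}(H)$ of a graph $H$ is the infimum of all $d\in[0,1]$ for which there is a constant $C=C(H,d)$ such that every $H$-free graph $G$ with minimum degree at least $d\,|V(G)|$ is homomorphic to some $H$-free graph $G'$ with at most $C$ vertices. Then the homomorphism threshold of the 5-cycle satisfies $\delta_{\mathrm{hom}}(C_5)\le \tfrac15$. -/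

import Mathlib

namespace HomThreshold

/-- `InForb H d G`: the finite graph `G` is `H`-free (it has no subgraph isomorphic to `H`) and its
minimum degree is at least `d * |V(G)|`. -/
def InForb {W : Type} (H : SimpleGraph W) (d : ℝ) {V : Type} [Fintype V] (G : SimpleGraph V)
    [DecidableRel G.Adj] : Prop :=
  H.Free G ∧ d * (Fintype.card V : ℝ) ≤ (G.minDegree : ℝ)

/-- The set of all `d ∈ [0, 1]` for which there is a constant `C` (depending only on `H` and `d`)
such that every `H`-free finite graph `G` of minimum degree at least `d * |V(G)|` is homomorphic to
an `H`-free graph on at most `C` vertices. -/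
def admissible {W : Type} (H : SimpleGraph W) : Set ℝ :=
  {d | d ∈ Set.Icc (0 : ℝ) 1 ∧
    ∃ C : ℕ, ∀ (V : Type) [Fintype V] (G : SimpleGraph V) [DecidableRel G.Adj],
      InForb H d G →
        ∃ (V' : Type) (_ : Fintype V') (G' : SimpleGraph V'),
          Fintype.card V' ≤ C ∧ H.Free G' ∧ Nonempty (G →g G')}

/-- The homomorphism threshold of the graph `H`. The infimum is a genuine one, see
`admissible_nonempty` and `admissible_bddBelow`. -/
noncomputable def homThreshold {W : Type} (H : SimpleGraph W) : ℝ :=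
  sInf (admissible H)

theorem admissible_bddBelow {W : Type} (H : SimpleGraph W) : BddBelow (admissible H) :=
  ⟨0, fun _ hd => hd.1.1⟩

theorem admissible_nonempty {W : Type} (H : SimpleGraph W) : (admissible H).Nonempty := by
  refine ⟨1, ⟨zero_le_one, le_rfl⟩, 0, ?_⟩
  intro V _ G _ hG
  refine ⟨V, inferInstance, G, ?_, hG.1, ⟨SimpleGraph.Hom.id⟩⟩
  by_contra hV
  have hne : Nonempty V := Fintype.card_pos_iff.mp (by omega)
  obtain ⟨v⟩ := hne
  have h1 := G.minDegree_le_degree v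
  have h2 := G.degree_lt_card_verts v
  have h3 : Fintype.card V ≤ G.minDegree := by
    have h4 := hG.2
    rw [one_mul] at h4
    exact_mod_cast h4
  omega

end HomThreshold

/-! Let `G` be pentagon-free on n vertices with minimum degree at least dn, where d > 1/5. If n >
750, six neighbourhoods of size at least n/5 cannot all have tiny pairwise overlaps; this excludes
triangles, hence all closed 5-walks (`no_closed_walk_five`).

A bounded tuple `f` dominates almost all vertices. Colour each vertex by the `f i` it reaches in two
steps, and refine this colouring 5T times. The target is the quotient by the final colour, whose
size depends only on d. A pentagon in it need not lift to a pentagon, but it unrolls to a walk `b`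
in `G` winding T times round it, colour by colour. A dominated vertex is adjacent to `b t` for at
most T + 1 of the indices t < 5T, while the degrees force an average of at least 5Td: a
contradiction for large T (`false_of_long_walk`). -/

/-! ### Excluding triangles and closed 5-walks -/

open Finset in
theorem card_le_of_pairwise_card_inter_le {V : Type} [Fintype V] [DecidableEq V] (P : Finset V)
    (s : V → Finset V) (hP : P.card = 6) (hs : ∀ p ∈ P, Fintype.card V ≤ 5 * (s p).card)
    (hi : ∀ p ∈ P, ∀ q ∈ P, p ≠ q → (s p ∩ s q).card ≤ 5) : Fintype.card V ≤ 750 := by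
  have hdisj : ∀ p ∈ P, ∀ q ∈ P, p ≠ q →
      Disjoint (s p \ (P.erase p).biUnion s) (s q \ (P.erase q).biUnion s) := by
    intro p hp q hq hpq
    rw [Finset.disjoint_left]
    intro x hx hx'
    rw [mem_sdiff] at hx hx'
    exact hx.2 (mem_biUnion.2 ⟨q, mem_erase.2 ⟨hpq.symm, hq⟩, hx'.1⟩)
  -- The five other sets cost `s p` at most 5 elements each. The six private parts are disjoint, so
  -- 6n ≤ 5(n + 150).
  have hcard : ∀ p ∈ P, (s p).card ≤ (s p \ (P.erase p).biUnion s).card + 25 := by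
    intro p hp
    have h1 := card_sdiff_add_card_inter (s p) ((P.erase p).biUnion s)
    have h2 : (s p ∩ (P.erase p).biUnion s).card ≤ 25 := by
      rw [inter_biUnion]
      refine (card_biUnion_le_card_mul _ _ 5 ?_).trans ?_
      · intro q hq
        rw [mem_erase] at hq
        exact hi p hp q hq.2 hq.1.symm
      · rw [card_erase_of_mem hp, hP]
    omega
  have h1 : ∑ p ∈ P, (s p \ (P.erase p).biUnion s).card ≤ Fintype.card V := by
    rw [← card_biUnion hdisj]
    exact card_le_univ _
  have h2 : P.card * Fintype.card V ≤
      ∑ p ∈ P, 5 * ((s p \ (P.erase p).biUnion s).card + 25) := by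
    rw [← smul_eq_mul]
    refine card_nsmul_le_sum _ _ _ fun p hp => ?_
    have := hs p hp
    have := hcard p hp
    omega
  rw [← mul_sum, sum_add_distrib, sum_const, hP, smul_eq_mul] at h2
  omega

namespace SimpleGraph

variable {V : Type}

theorem false_of_pentagon {G : SimpleGraph V} (hG : (cycleGraph 5).Free G) {a b c d e : V}
    (hab : G.Adj a b) (hbc : G.Adj b c) (hcd : G.Adj c d) (hde : G.Adj d e) (hea : G.Adj e a)
    (hac : a ≠ c) (had : a ≠ d) (hbd : b ≠ d) (hbe : b ≠ e) (hce : c ≠ e) : False := by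
  have h1 := hab.ne
  have h2 := hbc.ne
  have h3 := hcd.ne
  have h4 := hde.ne
  have h5 := hea.ne
  refine hG ⟨⟨⟨![a, b, c, d, e], ?_⟩, ?_⟩⟩
  · intro i j hij
    rw [cycleGraph_adj] at hij
    fin_cases i <;> fin_cases j <;> first
      | exact hab | exact hab.symm | exact hbc | exact hbc.symm | exact hcd | exact hcd.symm
      | exact hde | exact hde.symm | exact hea | exact hea.symm
      | (exfalso; revert hij; decide)
  · intro i j hij
    fin_cases i <;> fin_cases j <;> first
      | rfl
      | (exfalso; simp_all)

theorem exists_adj_notMem [Fintype V] (G : SimpleGraph V) [DecidableRel G.Adj] {v : V}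
    (s : Finset V) (h : s.card < (G.neighborFinset v).card) :
    ∃ w, G.Adj v w ∧ w ∉ s := by
  obtain ⟨w, hw, hws⟩ := Finset.exists_mem_notMem_of_card_lt_card h
  exact ⟨w, (G.mem_neighborFinset v w).1 hw, hws⟩

section Triangles

variable [Fintype V] [DecidableEq V] (G : SimpleGraph V) [DecidableRel G.Adj]

/-- Among six common neighbours of the edge, any two, y and z, have no common neighbour w besides p
and q, since p y w z q would be a pentagon. -/
theorem card_common_neighbors_le (hG : (cycleGraph 5).Free G)
    (hd : ∀ v, Fintype.card V ≤ 5 * (G.neighborFinset v).card) (hn : 750 < Fintype.card V)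
    {p q : V} (hpq : G.Adj p q) : (G.neighborFinset p ∩ G.neighborFinset q).card ≤ 5 := by
  by_contra! h
  obtain ⟨P, hP, hP6⟩ := Finset.exists_subset_card_eq (Nat.succ_le_of_lt h)
  refine absurd (card_le_of_pairwise_card_inter_le P (fun v => G.neighborFinset v) hP6
    (fun v _ => hd v) ?_) (not_le.2 hn)
  intro y hy z hz hyz
  have hy' := hP hy
  have hz' := hP hz
  simp only [Finset.mem_inter, mem_neighborFinset] at hy' hz'
  have hsub : G.neighborFinset y ∩ G.neighborFinset z ⊆ {p, q} := by
    intro w hw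
    simp only [Finset.mem_inter, mem_neighborFinset] at hw
    by_contra hw'
    simp only [Finset.mem_insert, Finset.mem_singleton, not_or] at hw'
    exact false_of_pentagon hG hy'.1 hw.1 hw.2.symm hz'.2.symm hpq.symm (Ne.symm hw'.1) hz'.1.ne
      hyz hy'.2.ne' hw'.2
  exact (Finset.card_le_card hsub).trans (Finset.card_le_two.trans (by norm_num))

/-- The six vertices are the triangle and one further neighbour of each corner. Of the 15 pairs, six
are edges; for the other nine, a common neighbour outside two triangle vertices closes a pentagon.
-/
theorem not_triangle_of_pentagon_free (hG : (cycleGraph 5).Free G)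
    (hd : ∀ v, Fintype.card V ≤ 5 * (G.neighborFinset v).card) (hn : 750 < Fintype.card V)
    {a b c : V} (hab : G.Adj a b) (hbc : G.Adj b c) (hca : G.Adj c a) : False := by
  have hbig : ∀ v, 5 < (G.neighborFinset v).card := fun v => by have := hd v; omega
  obtain ⟨x, hax, hx⟩ := G.exists_adj_notMem {b, c}
    ((Finset.card_le_two.trans (by norm_num)).trans_lt (hbig a))
  obtain ⟨y, hby, hy⟩ := G.exists_adj_notMem {a, c, x}
    ((Finset.card_le_three.trans (by norm_num)).trans_lt (hbig b))
  obtain ⟨z, hcz, hz⟩ := G.exists_adj_notMem {a, b, x, y}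
    ((Finset.card_le_four.trans (by norm_num)).trans_lt (hbig c))
  simp only [Finset.mem_insert, Finset.mem_singleton, not_or] at hx hy hz
  obtain ⟨hxb, hxc⟩ := hx
  obtain ⟨hya, hyc, hyx⟩ := hy
  obtain ⟨hza, hzb, hzx, hzy⟩ := hz
  have hedge : ∀ {p q : V}, G.Adj p q →
      (G.neighborFinset p ∩ G.neighborFinset q).card ≤ 5 :=
    fun h => G.card_common_neighbors_le hG hd hn h
  have hfar : ∀ {p q r s : V}, G.Adj p q → G.Adj q r → G.Adj r p → G.Adj p s → s ≠ q → s ≠ r →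
      (G.neighborFinset s ∩ G.neighborFinset q).card ≤ 5 := by
    intro p q r s hpq hqr hrp hps hsq hsr
    have hsub : G.neighborFinset s ∩ G.neighborFinset q ⊆ {p, r} := by
      intro w hw
      simp only [Finset.mem_inter, mem_neighborFinset] at hw
      by_contra hw'
      simp only [Finset.mem_insert, Finset.mem_singleton, not_or] at hw'
      exact false_of_pentagon hG hps hw.1 hw.2.symm hqr hrp (Ne.symm hw'.1) hpq.ne hsq hsr hw'.2
    exact (Finset.card_le_card hsub).trans (Finset.card_le_two.trans (by norm_num))
  have hopp : ∀ {p q s t : V}, G.Adj p q → G.Adj p s → G.Adj q t → s ≠ q → t ≠ p → s ≠ t →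
      (G.neighborFinset s ∩ G.neighborFinset t).card ≤ 5 := by
    intro p q s t hpq hps hqt hsq htp hst
    have hsub : G.neighborFinset s ∩ G.neighborFinset t ⊆ {p, q} := by
      intro w hw
      simp only [Finset.mem_inter, mem_neighborFinset] at hw
      by_contra hw'
      simp only [Finset.mem_insert, Finset.mem_singleton, not_or] at hw'
      exact false_of_pentagon hG hps hw.1 hw.2.symm hqt.symm hpq.symm (Ne.symm hw'.1) (Ne.symm htp)
        hst hsq hw'.2
    exact (Finset.card_le_card hsub).trans (Finset.card_le_two.trans (by norm_num))
  have hsymm : ∀ {p q : V}, (G.neighborFinset p ∩ G.neighborFinset q).card ≤ 5 →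
      (G.neighborFinset q ∩ G.neighborFinset p).card ≤ 5 := by
    intro p q h
    rwa [Finset.inter_comm]
  have e1 := hedge hab
  have e2 := hedge hbc
  have e3 := hedge hca
  have e4 := hedge hax
  have e5 := hedge hby
  have e6 := hedge hcz
  have f1 := hfar hab hbc hca hax hxb hxc
  have f2 := hfar hca.symm hbc.symm hab.symm hax hxc hxb
  have f3 := hfar hbc hca hab hby hyc hya
  have f4 := hfar hab.symm hca.symm hbc.symm hby hya hyc
  have f5 := hfar hca hab hbc hcz hza hzb
  have f6 := hfar hbc.symm hab.symm hca.symm hcz hzb hza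
  have g1 := hopp hab hax hby hxb hya (Ne.symm hyx)
  have g2 := hopp hbc hby hcz hyc hzb (Ne.symm hzy)
  have g3 := hopp hca hcz hax hza hxc hzx
  have hP : ({a, b, c, x, y, z} : Finset V).card = 6 := by
    rw [Finset.card_insert_of_notMem, Finset.card_insert_of_notMem, Finset.card_insert_of_notMem,
      Finset.card_insert_of_notMem, Finset.card_insert_of_notMem, Finset.card_singleton] <;>
    simp only [Finset.mem_insert, Finset.mem_singleton, not_or]
    exacts [Ne.symm hzy, ⟨Ne.symm hyx, Ne.symm hzx⟩, ⟨Ne.symm hxc, Ne.symm hyc, hcz.ne⟩,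
      ⟨hbc.ne, Ne.symm hxb, hby.ne, Ne.symm hzb⟩,
      ⟨hab.ne, hca.ne', hax.ne, Ne.symm hya, Ne.symm hza⟩]
  clear hedge hfar hopp
  obtain ⟨N, hN⟩ : ∃ N : V → Finset V, ∀ v, N v = G.neighborFinset v := ⟨_, fun _ => rfl⟩
  simp only [← hN] at hd hsymm e1 e2 e3 e4 e5 e6 f1 f2 f3 f4 f5 f6 g1 g2 g3
  refine absurd (card_le_of_pairwise_card_inter_le {a, b, c, x, y, z} N hP (fun v _ => hd v) ?_)
    (not_le.2 hn)
  simp only [Finset.forall_mem_insert, Finset.mem_singleton, forall_eq]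
  constructorm* _ ∧ _ <;> intro hpq <;> first
    | exact absurd rfl hpq
    | assumption
    | exact hsymm ‹_›

theorem no_closed_walk_five (hG : (cycleGraph 5).Free G)
    (hd : ∀ v, Fintype.card V ≤ 5 * (G.neighborFinset v).card) (hn : 750 < Fintype.card V)
    {a b c d e : V} (hab : G.Adj a b) (hbc : G.Adj b c) (hcd : G.Adj c d) (hde : G.Adj d e)
    (hea : G.Adj e a) : False := by
  have htri : ∀ {p q r : V}, G.Adj p q → G.Adj q r → G.Adj r p → False :=
    fun h1 h2 h3 => G.not_triangle_of_pentagon_free hG hd hn h1 h2 h3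
  refine false_of_pentagon hG hab hbc hcd hde hea ?_ ?_ ?_ ?_ ?_
  · rintro rfl
    exact htri hcd hde hea
  · rintro rfl
    exact htri hab hbc hcd
  · rintro rfl
    exact htri hde hea hab
  · rintro rfl
    exact htri hbc hcd hde
  · rintro rfl
    exact htri hea hab hbc

end Triangles

/-! ### Dominating almost all vertices by a bounded tuple -/

section Domination

variable [Fintype V] (G : SimpleGraph V) [DecidableRel G.Adj]

theorem exists_tuple_card_undominated_le [Nonempty V] {d : ℝ} (hd1 : d ≤ 1)
    (hd : ∀ v, d * Fintype.card V ≤ G.degree v) (K : ℕ) :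
    ∃ f : Fin K → V, ∃ U : Finset V, (∀ x, x ∉ U → ∃ i, G.Adj x (f i)) ∧
      (U.card : ℝ) ≤ (1 - d) ^ K * Fintype.card V := by
  classical
  induction K with
  | zero => exact ⟨Fin.elim0, Finset.univ, by simp, by simp⟩
  | succ K ih =>
    obtain ⟨f, U, hU, hcard⟩ := ih
    have hn : (0 : ℝ) < Fintype.card V := by exact_mod_cast Fintype.card_pos
    -- Greedy choice: by double counting, some vertex is adjacent to a proportion d of what is still
    -- undominated.
    obtain ⟨v, hv⟩ : ∃ v, d * U.card ≤ ((U.filter fun x => G.Adj x v).card : ℝ) := by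
      by_contra! h
      have h1 : ∑ v, ((U.filter fun x => G.Adj x v).card : ℝ) < ∑ _v : V, d * (U.card : ℝ) :=
        Finset.sum_lt_sum_of_nonempty Finset.univ_nonempty fun v _ => h v
      have h2 : ∑ v, (U.filter fun x => G.Adj x v).card = ∑ x ∈ U, G.degree x := by
        refine (Finset.sum_card_bipartiteAbove_eq_sum_card_bipartiteBelow
          (s := U) (t := Finset.univ) (fun x v => G.Adj x v)).symm.trans ?_
        refine Finset.sum_congr rfl fun x _ => ?_
        rw [← card_neighborFinset_eq_degree, neighborFinset_eq_filter]
        rfl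
      have h3 : (U.card : ℝ) * (d * Fintype.card V) ≤ ∑ x ∈ U, (G.degree x : ℝ) := by
        rw [← nsmul_eq_mul]
        exact Finset.card_nsmul_le_sum _ _ _ fun x _ => hd x
      rw [Finset.sum_const, Finset.card_univ, nsmul_eq_mul] at h1
      have h4 : ∑ v, ((U.filter fun x => G.Adj x v).card : ℝ) = ∑ x ∈ U, (G.degree x : ℝ) := by
        exact_mod_cast h2
      rw [h4] at h1
      nlinarith
    refine ⟨Fin.cons v f, U.filter fun x => ¬ G.Adj x v, ?_, ?_⟩
    · intro x hx
      by_cases hxU : x ∈ U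
      · refine ⟨0, ?_⟩
        by_contra hxv
        exact hx (Finset.mem_filter.2 ⟨hxU, hxv⟩)
      · obtain ⟨i, hi⟩ := hU x hxU
        exact ⟨i.succ, by simpa using hi⟩
    · have h1 : ((U.filter fun x => G.Adj x v).card : ℝ) +
          ((U.filter fun x => ¬ G.Adj x v).card : ℝ) = U.card := by
        exact_mod_cast Finset.card_filter_add_card_filter_not (s := U) (fun x => G.Adj x v)
      have h2 : (1 - d) * (U.card : ℝ) ≤ (1 - d) * ((1 - d) ^ K * Fintype.card V) :=
        mul_le_mul_of_nonneg_left hcard (by linarith)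
      rw [pow_succ]
      nlinarith

end Domination

/-! ### Colour refinement and lifting of walks -/

/-- The colours used after `k` rounds of colour refinement from a colouring by `α`. -/
def RefinedColor (α : Type) : ℕ → Type
  | 0 => α
  | k + 1 => RefinedColor α k × Set (RefinedColor α k)

instance RefinedColor.finite (α : Type) [Finite α] : ∀ k, Finite (RefinedColor α k)
  | 0 => inferInstanceAs (Finite α)
  | k + 1 =>
    have := RefinedColor.finite α k
    inferInstanceAs (Finite (RefinedColor α k × Set (RefinedColor α k)))

/-- `k` rounds of colour refinement. -/
def refine (G : SimpleGraph V) {α : Type} (c : V → α) : (k : ℕ) → V → RefinedColor α k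
  | 0 => c
  | k + 1 => fun v => (refine G c k v, refine G c k '' G.neighborSet v)

section Refine

variable {G : SimpleGraph V} {α : Type} {c : V → α}

theorem refine_eq_of_le {k l : ℕ} (hkl : k ≤ l) {u v : V} (h : G.refine c l u = G.refine c l v) :
    G.refine c k u = G.refine c k v := by
  induction l, hkl using Nat.le_induction with
  | base => exact h
  | succ l _ ih => exact ih (congrArg Prod.fst h)

theorem exists_adj_refine_eq {k : ℕ} {u v w : V} (h : G.refine c (k + 1) u = G.refine c (k + 1) v)
    (huw : G.Adj u w) : ∃ x, G.Adj v x ∧ G.refine c k x = G.refine c k w := by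
  have h1 : G.refine c k '' G.neighborSet u = G.refine c k '' G.neighborSet v :=
    congrArg Prod.snd h
  have h2 : G.refine c k w ∈ G.refine c k '' G.neighborSet v :=
    h1 ▸ Set.mem_image_of_mem _ huw
  exact h2

/-- Each step of the lifted walk spends one round of refinement, so agreement at depth L - t
survives at time t. -/
theorem exists_walk_refine_eq {L : ℕ} (u w : ℕ → V) (huw : ∀ t, G.Adj (u t) (w t))
    (hwu : ∀ t, G.refine c L (w t) = G.refine c L (u (t + 1))) :
    ∃ b : ℕ → V, (∀ t ≤ L, G.refine c (L - t) (b t) = G.refine c (L - t) (u t)) ∧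
      ∀ t < L, G.Adj (b t) (b (t + 1)) := by
  have hstep : ∀ t v, ∃ x, t < L → G.refine c (L - t) v = G.refine c (L - t) (u t) →
      G.Adj v x ∧ G.refine c (L - (t + 1)) x = G.refine c (L - (t + 1)) (u (t + 1)) := by
    intro t v
    by_cases h : t < L ∧ G.refine c (L - t) v = G.refine c (L - t) (u t)
    · obtain ⟨htL, hv⟩ := h
      obtain ⟨k, hk⟩ : ∃ k, L - t = k + 1 := ⟨L - t - 1, by omega⟩
      have hk' : L - (t + 1) = k := by omega
      rw [hk] at hv
      obtain ⟨x, hvx, hx⟩ := exists_adj_refine_eq hv.symm (huw t)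
      refine ⟨x, fun _ _ => ⟨hvx, ?_⟩⟩
      rw [hk', hx]
      exact refine_eq_of_le (by omega) (hwu t)
    · exact ⟨v, fun h1 h2 => absurd ⟨h1, h2⟩ h⟩
  choose g hg using hstep
  let b : ℕ → V := fun t => Nat.rec (u 0) (fun t v => g t v) t
  have hb : ∀ t, b (t + 1) = g t (b t) := fun _ => rfl
  have hcol : ∀ t ≤ L, G.refine c (L - t) (b t) = G.refine c (L - t) (u t) := by
    intro t
    induction t with
    | zero => exact fun _ => rfl
    | succ t ih =>
      intro ht
      rw [hb]
      exact (hg t (b t) ht (ih (by omega))).2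
  exact ⟨b, hcol, fun t ht => hb t ▸ (hg t (b t) ht (hcol t ht.le)).1⟩

end Refine

/-- The set of those `i` for which `v` and `f i` are joined by a walk of length two. -/
def twoStep (G : SimpleGraph V) {ι : Type} (f : ι → V) (v : V) : Set ι :=
  {i | ∃ y, G.Adj v y ∧ G.Adj y (f i)}

/-- The residues occurring in `S` are independent in the 5-cycle, so they lie in some {i, i + 2}. -/
theorem card_le_of_residues {T : ℕ} (S : Finset ℕ) (hS : ∀ t ∈ S, t < 5 * T)
    (h1 : ∀ t ∈ S, ∀ t' ∈ S, t' % 5 ≠ (t + 1) % 5) (h3 : ∀ t ∈ S, t + 3 ∉ S) :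
    S.card ≤ T + 1 := by
  obtain ⟨i, hi5, hi⟩ : ∃ i < 5, ∀ t ∈ S, t % 5 = i ∨ t % 5 = (i + 2) % 5 := by
    by_contra! h
    obtain ⟨t0, ht0, -⟩ := h 0 (by norm_num)
    obtain ⟨t1, ht1, h11, h12⟩ := h (t0 % 5) (Nat.mod_lt _ (by norm_num))
    obtain ⟨t2, ht2, h21, h22⟩ := h ((t0 + 3) % 5) (Nat.mod_lt _ (by norm_num))
    have a1 := h1 t0 ht0 t1 ht1
    have a2 := h1 t1 ht1 t0 ht0
    have a3 := h1 t0 ht0 t2 ht2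
    have a4 := h1 t2 ht2 t0 ht0
    have a5 := h1 t1 ht1 t2 ht2
    have a6 := h1 t2 ht2 t1 ht1
    omega
  -- Each t of residue i + 2 is paired with t + 3, of residue i. Two elements get the same label
  -- only if they differ by 3, which `h3` forbids.
  have hmap : ∀ t ∈ S, (if t % 5 = i then t / 5 else (t + 3) / 5) ∈ Finset.range (T + 1) := by
    intro t ht
    have := hS t ht
    rw [Finset.mem_range]
    split_ifs <;> omega
  have hinj : Set.InjOn (fun t => if t % 5 = i then t / 5 else (t + 3) / 5) S := by
    intro t ht t' ht' htt
    have a1 := hi t ht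
    have a2 := hi t' ht'
    have a3 : t' ≠ t + 3 := fun h => h3 t ht (h ▸ ht')
    have a4 : t ≠ t' + 3 := fun h => h3 t' ht' (h ▸ ht)
    dsimp only at htt
    split_ifs at htt <;> omega
  simpa using Finset.card_le_card_of_injOn _ hmap hinj

/-! ### The quotient graph is pentagon-free -/

section Quotient

variable [Fintype V] (G : SimpleGraph V) [DecidableRel G.Adj]

/-- The edges `u t`, `w t` represent the pentagon's edges, repeated with period 5. Counting pairs
(x, t) with x adjacent to `b t` bounds 5Tdn by n(T + 1) + 5Tηn. -/
theorem false_of_long_walk {T : ℕ} {d η : ℝ} {ι : Type} (f : ι → V) (U : Finset V)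
    (hG : ∀ {a b c d e : V}, G.Adj a b → G.Adj b c → G.Adj c d → G.Adj d e → G.Adj e a → False)
    (hd : ∀ v, d * Fintype.card V ≤ G.degree v)
    (hU : ∀ x, x ∉ U → ∃ i, G.Adj x (f i)) (hUc : (U.card : ℝ) ≤ η * Fintype.card V)
    (hT : T + 1 + 5 * T * η < 5 * T * d)
    (u w b : ℕ → V) (huw : ∀ t, G.Adj (u t) (w t)) (hu : ∀ t, u (t % 5) = u t)
    (hwu : ∀ t, G.twoStep f (w t) = G.twoStep f (u (t + 1)))
    (hbu : ∀ t < 5 * T, G.twoStep f (b t) = G.twoStep f (u t))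
    (hb : ∀ t, t + 1 < 5 * T → G.Adj (b t) (b (t + 1))) : False := by
  classical
  have hn : (0 : ℝ) < Fintype.card V := by
    have : Nonempty V := ⟨u 0⟩
    exact_mod_cast Fintype.card_pos
  have hgood : ∀ x, x ∉ U → ((Finset.range (5 * T)).filter fun t => G.Adj x (b t)).card ≤ T + 1 := by
    intro x hx
    obtain ⟨i, hi⟩ := hU x hx
    refine card_le_of_residues _ (fun t ht => Finset.mem_range.1 (Finset.mem_filter.1 ht).1) ?_ ?_
    -- If x sees times t and t' ≡ t + 1, both ends of the edge `u t`, `w t` reach `f i` in two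
    -- steps: a closed 5-walk.
    · intro t ht t' ht' htt
      rw [Finset.mem_filter, Finset.mem_range] at ht ht'
      have h1 : i ∈ G.twoStep f (u t) := hbu t ht.1 ▸ ⟨x, ht.2.symm, hi⟩
      have h2 : i ∈ G.twoStep f (w t) := by
        rw [hwu, ← hu (t + 1), ← htt, hu, ← hbu t' ht'.1]
        exact ⟨x, ht'.2.symm, hi⟩
      obtain ⟨y, hy1, hy2⟩ := h1
      obtain ⟨z, hz1, hz2⟩ := h2
      exact hG (huw t) hz1 hz2 hy2.symm hy1.symm
    -- Here x and four consecutive vertices of `b` form a closed 5-walk.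
    · intro t ht ht'
      rw [Finset.mem_filter, Finset.mem_range] at ht ht'
      exact hG ht.2 (hb t (by omega)) (hb (t + 1) (by omega)) (hb (t + 2) (by omega)) ht'.2.symm
  have hsum : ∑ t ∈ Finset.range (5 * T), G.degree (b t) =
      ∑ x, ((Finset.range (5 * T)).filter fun t => G.Adj x (b t)).card := by
    refine Eq.trans ?_ (Finset.sum_card_bipartiteAbove_eq_sum_card_bipartiteBelow
      (s := Finset.range (5 * T)) (t := Finset.univ) (fun t x => G.Adj x (b t)))
    refine Finset.sum_congr rfl fun t _ => ?_
    rw [← card_neighborFinset_eq_degree, neighborFinset_eq_filter]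
    simp only [Finset.bipartiteAbove, G.adj_comm]
  have hlow : (5 * T : ℕ) * (d * Fintype.card V) ≤
      ∑ t ∈ Finset.range (5 * T), (G.degree (b t) : ℝ) := by
    rw [← nsmul_eq_mul]
    conv_lhs => rw [← Finset.card_range (5 * T)]
    exact Finset.card_nsmul_le_sum _ _ _ fun t _ => hd (b t)
  have hup : ∑ x, ((Finset.range (5 * T)).filter fun t => G.Adj x (b t)).card ≤
      Fintype.card V * (T + 1) + U.card * (5 * T) := by
    have h1 : ∀ x, ((Finset.range (5 * T)).filter fun t => G.Adj x (b t)).card ≤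
        (T + 1) + if x ∈ U then 5 * T else 0 := by
      intro x
      split_ifs with hx
      · have := Finset.card_filter_le (Finset.range (5 * T)) (fun t => G.Adj x (b t))
        rw [Finset.card_range] at this
        omega
      · simpa using hgood x hx
    refine (Finset.sum_le_sum fun x _ => h1 x).trans_eq ?_
    rw [Finset.sum_add_distrib, Finset.sum_const, Finset.card_univ, ← Finset.sum_filter,
      Finset.sum_const, Finset.filter_mem_eq_inter, Finset.univ_inter, smul_eq_mul, smul_eq_mul]
  have h1 : (5 * T : ℕ) * (d * Fintype.card V) ≤
      (Fintype.card V * (T + 1) + U.card * (5 * T) : ℝ) := by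
    refine hlow.trans ?_
    rw [← hsum] at hup
    exact_mod_cast hup
  push_cast at h1
  have h2 : (U.card : ℝ) * (5 * T) ≤ η * Fintype.card V * (5 * T) :=
    mul_le_mul_of_nonneg_right hUc (by positivity)
  have h3 := mul_lt_mul_of_pos_right hT hn
  nlinarith

theorem exists_hom_refinedColor {T K : ℕ} {d η : ℝ} (f : Fin K → V) (U : Finset V)
    (hG : ∀ {a b c d e : V}, G.Adj a b → G.Adj b c → G.Adj c d → G.Adj d e → G.Adj e a → False)
    (hd : ∀ v, d * Fintype.card V ≤ G.degree v) (hηd : η < d)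
    (hU : ∀ x, x ∉ U → ∃ i, G.Adj x (f i)) (hUc : (U.card : ℝ) ≤ η * Fintype.card V)
    (hT : T + 1 + 5 * T * η < 5 * T * d) :
    ∃ G' : SimpleGraph (RefinedColor (Set (Fin K)) (5 * T)),
      (cycleGraph 5).Free G' ∧ Nonempty (G →g G') := by
  let P := G.refine (G.twoStep f) (5 * T)
  -- As η < d, some neighbour of u is dominated by an `f i`. Were the colours equal, v would also
  -- reach `f i` in two steps, closing a 5-walk.
  have hloop : ∀ {u v}, G.Adj u v → P u ≠ P v := by
    intro u v huv hP
    have hc : G.twoStep f u = G.twoStep f v := refine_eq_of_le (c := G.twoStep f) (Nat.zero_le (5 * T)) hP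
    have hn : (0 : ℝ) < Fintype.card V := by
      have : Nonempty V := ⟨u⟩
      exact_mod_cast Fintype.card_pos
    have hlt : U.card < (G.neighborFinset u).card := by
      rw [card_neighborFinset_eq_degree]
      have : (U.card : ℝ) < G.degree u := by linarith [hd u, mul_lt_mul_of_pos_right hηd hn]
      exact_mod_cast this
    obtain ⟨y, hy, hyU⟩ := Finset.exists_mem_notMem_of_card_lt_card hlt
    rw [mem_neighborFinset] at hy
    obtain ⟨i, hi⟩ := hU y hyU
    have h1 : i ∈ G.twoStep f v := hc ▸ ⟨y, hy, hi⟩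
    obtain ⟨z, hz1, hz2⟩ := h1
    exact hG huv hz1 hz2 hi.symm hy.symm
  let G' : SimpleGraph (RefinedColor (Set (Fin K)) (5 * T)) :=
    { Adj := fun p q => ∃ u v, G.Adj u v ∧ P u = p ∧ P v = q
      symm := ⟨fun _ _ ⟨u, v, h, hu, hv⟩ => ⟨v, u, h.symm, hv, hu⟩⟩
      loopless := ⟨fun _ ⟨_, _, h, hu, hv⟩ => hloop h (hu.trans hv.symm)⟩ }
  refine ⟨G', ?_, ⟨⟨P, fun {u v} h => ⟨u, v, h, rfl, rfl⟩⟩⟩⟩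
  rintro ⟨φ⟩
  have hφ : ∀ i : Fin 5, ∃ u v, G.Adj u v ∧ P u = φ i ∧ P v = φ (i + 1) := by
    intro i
    have h : (cycleGraph 5).Adj i (i + 1) := by
      revert i
      decide
    exact φ.toHom.map_rel h
  choose u w huw hu hw using hφ
  have hwu : ∀ i, P (w i) = P (u (i + 1)) := fun i => (hw i).trans (hu (i + 1)).symm
  have hcast : ∀ t : ℕ, Fin.ofNat 5 (t + 1) = Fin.ofNat 5 t + 1 := by
    intro t
    ext
    simp [Fin.val_add]
  obtain ⟨b, hb1, hb2⟩ := exists_walk_refine_eq (c := G.twoStep f) (L := 5 * T)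
    (fun t : ℕ => u (Fin.ofNat 5 t)) (fun t : ℕ => w (Fin.ofNat 5 t)) (fun t => huw _)
    (fun t => by rw [hcast]; exact hwu _)
  refine G.false_of_long_walk (T := T) f U hG hd hU hUc hT (fun t : ℕ => u (Fin.ofNat 5 t))
    (fun t : ℕ => w (Fin.ofNat 5 t)) b (fun t => huw _) ?_ ?_ ?_ ?_
  · intro t
    have : Fin.ofNat 5 (t % 5) = Fin.ofNat 5 t := by
      ext
      simp
    simp only [this]
  · intro t
    simp only [hcast]
    exact refine_eq_of_le (c := G.twoStep f) (Nat.zero_le (5 * T)) (hwu _)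
  · intro t ht
    exact refine_eq_of_le (c := G.twoStep f) (Nat.zero_le (5 * T - t)) (hb1 t ht.le)
  · exact fun t ht => hb2 t (by omega)

end Quotient

end SimpleGraph

theorem HomThreshold.mem_admissible_cycleGraph_five {d : ℝ} (hd : 1 / 5 < d) (hd1 : d ≤ 1) :
    d ∈ HomThreshold.admissible (SimpleGraph.cycleGraph 5) := by
  classical
  refine ⟨⟨by linarith, hd1⟩, ?_⟩
  -- Half of the excess d - 1/5 pays for the undominated vertices; T is chosen so that the other
  -- half, times 5T, exceeds 1.
  obtain ⟨T, hT⟩ := exists_nat_gt (2 / (5 * (d - 1 / 5)))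
  obtain ⟨K, hK⟩ := exists_pow_lt_of_lt_one (show (0 : ℝ) < (d - 1 / 5) / 2 by linarith)
    (show 1 - d < 1 by linarith)
  have hT' : (T : ℝ) + 1 + 5 * T * ((d - 1 / 5) / 2) < 5 * T * d := by
    rw [div_lt_iff₀ (by linarith)] at hT
    nlinarith
  have := Fintype.ofFinite (SimpleGraph.RefinedColor (Set (Fin K)) (5 * T))
  refine ⟨max 750 (Fintype.card (SimpleGraph.RefinedColor (Set (Fin K)) (5 * T))), ?_⟩
  intro V _ G _ hG
  by_cases hn : Fintype.card V ≤ 750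
  · exact ⟨V, inferInstance, G, le_max_of_le_left hn, hG.1, ⟨SimpleGraph.Hom.id⟩⟩
  rw [not_le] at hn
  have : Nonempty V := Fintype.card_pos_iff.1 (by omega)
  have hdeg : ∀ v, d * Fintype.card V ≤ G.degree v := fun v =>
    hG.2.trans (by exact_mod_cast G.minDegree_le_degree v)
  have hdeg5 : ∀ v, Fintype.card V ≤ 5 * (G.neighborFinset v).card := by
    intro v
    have h1 := hdeg v
    have h2 : (Fintype.card V : ℝ) ≤ 5 * G.degree v := by
      have : (0 : ℝ) ≤ Fintype.card V := Nat.cast_nonneg _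
      nlinarith
    rw [SimpleGraph.card_neighborFinset_eq_degree]
    exact_mod_cast h2
  obtain ⟨f, U, hU, hUc⟩ := G.exists_tuple_card_undominated_le hd1 hdeg K
  obtain ⟨G', hG', hom⟩ := G.exists_hom_refinedColor (T := T) (η := (d - 1 / 5) / 2) f U
    (G.no_closed_walk_five hG.1 hdeg5 hn) hdeg (by linarith) hU
    (hUc.trans (mul_le_mul_of_nonneg_right hK.le (Nat.cast_nonneg _))) hT'
  exact ⟨_, inferInstance, G', le_max_right _ _, hG', hom⟩

theorem mainTheorem6 :
    HomThreshold.homThreshold (SimpleGraph.cycleGraph 5) ≤ 1 / 5 := by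
  refine le_of_forall_gt_imp_ge_of_dense fun d hd => ?_
  by_cases hd1 : d ≤ 1
  · exact csInf_le (HomThreshold.admissible_bddBelow _)
      (HomThreshold.mem_admissible_cycleGraph_five hd hd1)
  · exact (csInf_le (HomThreshold.admissible_bddBelow _)
      (HomThreshold.mem_admissible_cycleGraph_five (by norm_num) le_rfl)).trans (not_le.1 hd1).le
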